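/- There is an absolute constant $C>0$ such that the following holds for every integer $n\ge 0$, every positive semidefinite Hankel matrix $H\in\mathbb{R}^{n\times n}$ (that is, $H$ is symmetric positive semidefinite and $H_{i,j}=H_{k,l}$ whenever $i+j=k+l$), and every $\epsilon>0$. There exists a Hankel matrix $\widehat H\in\mathbb{R}^{n\times n}$ with $$\operatorname{rank}\widehat H\;\le\; C\cdot\max(1,\log_2 n)\cdot\max(1,\log_2(1/\epsilon))$$ (with the convention $\max(1,\log_2 0)=1$) such that $$\|H-\widehat H\|_2\le\epsilon\|H\|_2\quad\text{and}\quad\|H-\widehat H\|_F\le\epsilon\|H\|_F,$$ where $\|\cdot\|_2$ is the spectral norm (the operator norm induced by the Euclidean norm) and $\|\cdot\|_F$ is the Frobenius norm. In particular, for $n\ge 2$ and $0<\epsilon\le 1/2$ the rank of $\widehat H$ is at most $C\log_2 n\,\log_2(1/\epsilon)$. -/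

import Mathlib

/-- A square matrix is Hankel if it is constant along each of its anti-diagonals. The sum of the
indices is taken in `ℕ`, not modulo `n`. -/
def IsHankel {n : ℕ} (A : Matrix (Fin n) (Fin n) ℝ) : Prop :=
  ∀ i j k l : Fin n, (i : ℕ) + (j : ℕ) = (k : ℕ) + (l : ℕ) → A i j = A k l

open scoped Matrix.Norms.L2Operator in
/-- The spectral norm of a real square matrix: its operator norm for the Euclidean norm. -/
noncomputable def matrixSpectralNorm {n : ℕ} (A : Matrix (Fin n) (Fin n) ℝ) : ℝ := ‖A‖

open scoped Matrix.Norms.Frobenius in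
/-- The Frobenius norm of a real square matrix. -/
noncomputable def matrixFrobeniusNorm {n : ℕ} (A : Matrix (Fin n) (Fin n) ℝ) : ℝ := ‖A‖

/-!
A positive definite Hankel matrix is a moment matrix `H i j = ∑ t, w t * x t ^ (i + j)` with
nonnegative weights and real nodes (`IsHankel.exists_eq_momentMatrix`); a semidefinite one becomes
definite after an arbitrarily small Hankel perturbation. Sorting the nodes into `[0, 1]`,
`[-1, 0)`, `(1, ∞)` and `(-∞, -1)` writes `H` as a sum of four positive semidefinite matrices.
Neither norm decreases when a positive semidefinite matrix is added to another one, so each summand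
may be approximated separately, relative to its own norm. The change of variable `x ↦ -x` conjugates
by a diagonal sign matrix and `x ↦ x⁻¹` reverses rows and columns, which leaves nodes in `[0, 1]`.

There, the Taylor expansion at `a` of `x ^ k` as a function of `x`, cut after `r` terms, depends on
`k` through `r` functions that span a translation invariant space. It therefore gives a Hankel
matrix of rank at most `r`, the same for all nodes sharing the centre `a`
(`rank_sum_taylor_le`). Its error is at most `2⁻ʳ (a + 2 |x - a|)^k` (`abs_pow_sub_taylor_le`).
With the centres `1 - (3/4)^p`, of which `O(log n)` suffice because `k < 2 n`, this is at most
`4 * 2⁻ʳ x^(k/3)` (`exists_centre_pow_le`). The exponent `k / 3` in place of `k` is harmless: the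
error matrix is dominated entrywise by a multiple of the matrix with entries `G ⌊i/3⌋ ⌊j/3⌋`, where
`G` is the moment matrix, and this has norm at most `3 ‖G‖`. The bound has no dependence on the
number of centres, so that `r = O(log (1/ε))` is enough, in both norms at once.
-/

/-! ### Spectral and Frobenius norms -/

open scoped MatrixOrder in
theorem Matrix.PosSemidef.exists_eq_conjTranspose_mul_self {n : ℕ}
    {A : Matrix (Fin n) (Fin n) ℝ} (hA : A.PosSemidef) :
    ∃ S : Matrix (Fin n) (Fin n) ℝ, A = S.conjTranspose * S :=
  CStarAlgebra.nonneg_iff_eq_star_mul_self.mp hA.nonneg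

open scoped MatrixOrder in
theorem Matrix.PosDef.exists_isUnit_eq_conjTranspose_mul_self {n : ℕ}
    {A : Matrix (Fin n) (Fin n) ℝ} (hA : A.PosDef) :
    ∃ S : Matrix (Fin n) (Fin n) ℝ, IsUnit S ∧ A = S.conjTranspose * S :=
  CStarAlgebra.isStrictlyPositive_iff_eq_star_mul_self.mp hA.isStrictlyPositive

open scoped Matrix.Norms.L2Operator in
theorem matrixSpectralNorm_le_of_forall {n : ℕ} (A : Matrix (Fin n) (Fin n) ℝ) {c : ℝ}
    (hc : 0 ≤ c)
    (h : ∀ v : Fin n → ℝ, ∑ i, (A.mulVec v i) ^ 2 ≤ c ^ 2 * ∑ i, v i ^ 2) :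
    matrixSpectralNorm A ≤ c := by
  unfold matrixSpectralNorm
  rw [← Matrix.l2_opNorm_toEuclideanCLM]
  refine ContinuousLinearMap.opNorm_le_bound _ hc fun v => ?_
  rw [EuclideanSpace.norm_eq, EuclideanSpace.norm_eq, ← Real.sqrt_sq hc,
    ← Real.sqrt_mul (sq_nonneg c)]
  refine Real.sqrt_le_sqrt ?_
  simpa [Matrix.ofLp_toEuclideanCLM] using h v.ofLp

open scoped Matrix.Norms.L2Operator in
theorem sum_mulVec_sq_le {n : ℕ} (A : Matrix (Fin n) (Fin n) ℝ) (v : Fin n → ℝ) :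
    ∑ i, (A.mulVec v i) ^ 2 ≤ matrixSpectralNorm A ^ 2 * ∑ i, v i ^ 2 := by
  have h := Matrix.l2_opNorm_mulVec A (WithLp.toLp 2 v)
  have h2 := pow_le_pow_left₀ (norm_nonneg _) h 2
  rw [mul_pow, EuclideanSpace.norm_sq_eq, EuclideanSpace.norm_sq_eq] at h2
  simpa [matrixSpectralNorm] using h2

open scoped Matrix.Norms.L2Operator in
theorem matrixSpectralNorm_nonneg {n : ℕ} (A : Matrix (Fin n) (Fin n) ℝ) :
    0 ≤ matrixSpectralNorm A := norm_nonneg _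

open scoped Matrix.Norms.L2Operator in
theorem matrixSpectralNorm_add_le {n : ℕ} (A B : Matrix (Fin n) (Fin n) ℝ) :
    matrixSpectralNorm (A + B) ≤ matrixSpectralNorm A + matrixSpectralNorm B := norm_add_le _ _

open scoped Matrix.Norms.L2Operator in
theorem matrixSpectralNorm_smul {n : ℕ} (c : ℝ) (A : Matrix (Fin n) (Fin n) ℝ) :
    matrixSpectralNorm (c • A) = |c| * matrixSpectralNorm A := norm_smul _ _

open scoped Matrix.Norms.L2Operator in
theorem matrixSpectralNorm_pos {n : ℕ} {A : Matrix (Fin n) (Fin n) ℝ} (h : A ≠ 0) :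
    0 < matrixSpectralNorm A := norm_pos_iff.2 h

open scoped Matrix.Norms.Frobenius in
theorem matrixFrobeniusNorm_nonneg {n : ℕ} (A : Matrix (Fin n) (Fin n) ℝ) :
    0 ≤ matrixFrobeniusNorm A := norm_nonneg _

open scoped Matrix.Norms.Frobenius in
theorem matrixFrobeniusNorm_add_le {n : ℕ} (A B : Matrix (Fin n) (Fin n) ℝ) :
    matrixFrobeniusNorm (A + B) ≤ matrixFrobeniusNorm A + matrixFrobeniusNorm B := norm_add_le _ _

open scoped Matrix.Norms.Frobenius in
theorem matrixFrobeniusNorm_smul {n : ℕ} (c : ℝ) (A : Matrix (Fin n) (Fin n) ℝ) :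
    matrixFrobeniusNorm (c • A) = |c| * matrixFrobeniusNorm A := norm_smul _ _

open scoped Matrix.Norms.Frobenius in
theorem matrixFrobeniusNorm_pos {n : ℕ} {A : Matrix (Fin n) (Fin n) ℝ} (h : A ≠ 0) :
    0 < matrixFrobeniusNorm A := norm_pos_iff.2 h

open scoped Matrix.Norms.Frobenius in
theorem matrixFrobeniusNorm_eq {n : ℕ} (A : Matrix (Fin n) (Fin n) ℝ) :
    matrixFrobeniusNorm A = √(∑ i, ∑ j, A i j ^ 2) := by
  simp [matrixFrobeniusNorm, Matrix.frobenius_norm_def, Real.sqrt_eq_rpow]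

/-- The spectral norm, too, grows with the absolute values of the entries: test `E` on `v` and `B`
on `|v|`. -/
theorem matrixSpectralNorm_mono {n : ℕ} {E B : Matrix (Fin n) (Fin n) ℝ}
    (h : ∀ i j, |E i j| ≤ B i j) : matrixSpectralNorm E ≤ matrixSpectralNorm B := by
  refine matrixSpectralNorm_le_of_forall _ (matrixSpectralNorm_nonneg _) fun v => ?_
  have := sum_mulVec_sq_le B fun i => |v i|
  simp only [sq_abs] at this
  refine le_trans (Finset.sum_le_sum fun i _ => ?_) this
  rw [← sq_abs (E.mulVec v i)]
  refine pow_le_pow_left₀ (abs_nonneg _) ?_ 2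
  simp only [Matrix.mulVec, dotProduct]
  refine (Finset.abs_sum_le_sum_abs _ _).trans (Finset.sum_le_sum fun j _ => ?_)
  rw [abs_mul]
  exact mul_le_mul_of_nonneg_right (h i j) (abs_nonneg _)

theorem matrixFrobeniusNorm_mono {n : ℕ} {E B : Matrix (Fin n) (Fin n) ℝ}
    (h : ∀ i j, |E i j| ≤ B i j) : matrixFrobeniusNorm E ≤ matrixFrobeniusNorm B := by
  rw [matrixFrobeniusNorm_eq, matrixFrobeniusNorm_eq]
  refine Real.sqrt_le_sqrt (Finset.sum_le_sum fun i _ => Finset.sum_le_sum fun j _ => ?_)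
  rw [← sq_abs]
  exact pow_le_pow_left₀ (abs_nonneg _) (h i j) 2

theorem sum_comp_le_mul_sum {n : ℕ} {c : ℕ} {f : Fin n → Fin n}
    (hf : ∀ a, (Finset.univ.filter fun i => f i = a).card ≤ c) {φ : Fin n → ℝ}
    (hφ : ∀ a, 0 ≤ φ a) : ∑ i, φ (f i) ≤ c * ∑ a, φ a := by
  rw [← Finset.sum_fiberwise_of_maps_to (t := Finset.univ) (g := f) (by simp), Finset.mul_sum]
  refine Finset.sum_le_sum fun a _ => ?_
  rw [Finset.sum_congr rfl (g := fun _ => φ a) (by intro i hi; rw [(Finset.mem_filter.1 hi).2]),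
    Finset.sum_const, nsmul_eq_mul]
  exact mul_le_mul_of_nonneg_right (by exact_mod_cast hf a) (hφ a)

theorem matrixFrobeniusNorm_submatrix_le {n : ℕ} {c : ℕ} {f : Fin n → Fin n}
    (hf : ∀ a, (Finset.univ.filter fun i => f i = a).card ≤ c) (A : Matrix (Fin n) (Fin n) ℝ) :
    matrixFrobeniusNorm (A.submatrix f f) ≤ c * matrixFrobeniusNorm A := by
  rw [matrixFrobeniusNorm_eq, matrixFrobeniusNorm_eq, ← Real.sqrt_sq (Nat.cast_nonneg (α := ℝ) c),
    ← Real.sqrt_mul (sq_nonneg _)]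
  refine Real.sqrt_le_sqrt ?_
  simp only [Matrix.submatrix_apply]
  calc ∑ i, ∑ j, A (f i) (f j) ^ 2
      ≤ c * ∑ a, ∑ j, A a (f j) ^ 2 :=
        sum_comp_le_mul_sum (φ := fun a => ∑ j, A a (f j) ^ 2) hf fun a => by positivity
    _ ≤ c * ∑ a, c * ∑ b, A a b ^ 2 := by
        gcongr with a
        exact sum_comp_le_mul_sum (φ := fun b => A a b ^ 2) hf fun a => by positivity
    _ = _ := by rw [← Finset.mul_sum]; ring

/-- Repeating rows and columns at most `c` times multiplies the spectral norm by at most `c`. -/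
theorem matrixSpectralNorm_submatrix_le {n : ℕ} {c : ℕ} {f : Fin n → Fin n}
    (hf : ∀ a, (Finset.univ.filter fun i => f i = a).card ≤ c) (A : Matrix (Fin n) (Fin n) ℝ) :
    matrixSpectralNorm (A.submatrix f f) ≤ c * matrixSpectralNorm A := by
  refine matrixSpectralNorm_le_of_forall _
    (mul_nonneg (Nat.cast_nonneg _) (matrixSpectralNorm_nonneg _)) fun v => ?_
  -- `w` adds up the coordinates of `v` over each fibre of `f`.
  let w : Fin n → ℝ := fun a => ∑ i with f i = a, v i
  have hw : ∀ i, (A.submatrix f f).mulVec v i = A.mulVec w (f i) := by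
    intro i
    simp only [Matrix.mulVec, dotProduct, Matrix.submatrix_apply, w, Finset.mul_sum]
    rw [← Finset.sum_fiberwise_of_maps_to (t := Finset.univ) (g := f) (by simp)]
    refine Finset.sum_congr rfl fun a _ => Finset.sum_congr rfl fun j hj => ?_
    rw [(Finset.mem_filter.1 hj).2]
  have hww : ∑ a, w a ^ 2 ≤ c * ∑ i, v i ^ 2 := by
    rw [← Finset.sum_fiberwise_of_maps_to (s := Finset.univ) (t := Finset.univ) (g := f)
      (f := fun i => v i ^ 2) (by simp), Finset.mul_sum]
    refine Finset.sum_le_sum fun a _ => (sq_sum_le_card_mul_sum_sq).trans ?_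
    exact mul_le_mul_of_nonneg_right (by exact_mod_cast hf a) (by positivity)
  simp only [hw]
  calc ∑ i, A.mulVec w (f i) ^ 2 ≤ c * ∑ a, A.mulVec w a ^ 2 :=
        sum_comp_le_mul_sum (φ := fun a => A.mulVec w a ^ 2) hf fun a => by positivity
    _ ≤ c * (matrixSpectralNorm A ^ 2 * (c * ∑ i, v i ^ 2)) := by
        gcongr
        exact (sum_mulVec_sq_le A w).trans (by gcongr)
    _ = _ := by ring

theorem Matrix.PosSemidef.trace_mul_nonneg {n : ℕ} {A B : Matrix (Fin n) (Fin n) ℝ}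
    (hA : A.PosSemidef) (hB : B.PosSemidef) : 0 ≤ (A * B).trace := by
  obtain ⟨T, rfl⟩ := hB.exists_eq_conjTranspose_mul_self
  rw [← Matrix.mul_assoc, Matrix.trace_mul_comm, ← Matrix.mul_assoc]
  exact (hA.mul_mul_conjTranspose_same T).trace_nonneg

theorem Matrix.PosSemidef.frobeniusNorm_le_add {n : ℕ} {A B : Matrix (Fin n) (Fin n) ℝ}
    (hA : A.PosSemidef) (hB : B.PosSemidef) :
    matrixFrobeniusNorm A ≤ matrixFrobeniusNorm (A + B) := by
  rw [matrixFrobeniusNorm_eq, matrixFrobeniusNorm_eq]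
  refine Real.sqrt_le_sqrt ?_
  have h : 0 ≤ ∑ i, ∑ j, A i j * B i j := by
    have := hA.trace_mul_nonneg hB
    simp only [Matrix.trace, Matrix.diag, Matrix.mul_apply] at this
    refine this.trans_eq (Finset.sum_congr rfl fun i _ => Finset.sum_congr rfl fun j _ => ?_)
    rw [← hB.isHermitian.apply i j]; simp
  have h2 : ∑ i, ∑ j, (A + B) i j ^ 2 =
      ∑ i, ∑ j, A i j ^ 2 + 2 * ∑ i, ∑ j, A i j * B i j + ∑ i, ∑ j, B i j ^ 2 := by
    simp only [Finset.mul_sum, ← Finset.sum_add_distrib]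
    refine Finset.sum_congr rfl fun i _ => Finset.sum_congr rfl fun j _ => ?_
    rw [Matrix.add_apply]; ring
  have h3 : 0 ≤ ∑ i, ∑ j, B i j ^ 2 := by positivity
  linarith

open scoped Matrix.Norms.L2Operator in
/-- Write `A = Sᵀ S` and `A + B = Tᵀ T`; then `‖S v‖ ≤ ‖T v‖` for all `v`, and `‖A‖ = ‖S‖ ^ 2`. -/
theorem Matrix.PosSemidef.spectralNorm_le_add {n : ℕ} {A B : Matrix (Fin n) (Fin n) ℝ}
    (hA : A.PosSemidef) (hB : B.PosSemidef) :
    matrixSpectralNorm A ≤ matrixSpectralNorm (A + B) := by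
  obtain ⟨S, hS⟩ := hA.exists_eq_conjTranspose_mul_self
  obtain ⟨T, hT⟩ := (hA.add hB).exists_eq_conjTranspose_mul_self
  have key : ∀ (R : Matrix (Fin n) (Fin n) ℝ) (v : Fin n → ℝ),
      ∑ i, (R.mulVec v i) ^ 2 = dotProduct v ((R.conjTranspose * R).mulVec v) := by
    intro R v
    rw [← Matrix.mulVec_mulVec, Matrix.dotProduct_mulVec, Matrix.conjTranspose_eq_transpose_of_trivial,
      Matrix.vecMul_transpose]
    simp [dotProduct, sq]
  have hST : matrixSpectralNorm S ≤ matrixSpectralNorm T := by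
    refine matrixSpectralNorm_le_of_forall _ (matrixSpectralNorm_nonneg _) fun v => ?_
    refine le_trans ?_ (sum_mulVec_sq_le T v)
    rw [key, key, ← hS, ← hT, Matrix.add_mulVec, dotProduct_add]
    have := hB.dotProduct_mulVec_nonneg v
    simp only [star_trivial] at this
    linarith
  rw [hT, hS]
  unfold matrixSpectralNorm at *
  rw [Matrix.l2_opNorm_conjTranspose_mul_self, Matrix.l2_opNorm_conjTranspose_mul_self]
  exact mul_self_le_mul_self (norm_nonneg _) hST

/-! ### Operations on approximable matrices -/

/-- `HankelApproximable A R η` says that `A` has a Hankel approximant of rank at most `R` whose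
relative error is at most `η` both in the spectral norm and in the Frobenius norm. -/
def HankelApproximable {n : ℕ} (A : Matrix (Fin n) (Fin n) ℝ) (R : ℕ) (η : ℝ) : Prop :=
  ∃ B : Matrix (Fin n) (Fin n) ℝ, IsHankel B ∧ B.rank ≤ R ∧
    matrixSpectralNorm (A - B) ≤ η * matrixSpectralNorm A ∧
    matrixFrobeniusNorm (A - B) ≤ η * matrixFrobeniusNorm A

theorem IsHankel.add {n : ℕ} {A B : Matrix (Fin n) (Fin n) ℝ} (hA : IsHankel A)
    (hB : IsHankel B) : IsHankel (A + B) := fun i j k l h => by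
  rw [Matrix.add_apply, Matrix.add_apply, hA i j k l h, hB i j k l h]

theorem IsHankel.smul {n : ℕ} {A : Matrix (Fin n) (Fin n) ℝ} (c : ℝ) (hA : IsHankel A) :
    IsHankel (c • A) := fun i j k l h => by
  rw [Matrix.smul_apply, Matrix.smul_apply, hA i j k l h]

theorem Matrix.rank_add_le_rank_add_rank {m n : Type*} [Fintype m] [Fintype n]
    (A B : Matrix m n ℝ) : (A + B).rank ≤ A.rank + B.rank := by
  unfold Matrix.rank
  rw [Matrix.mulVecLin_add]
  refine (Submodule.finrank_mono (LinearMap.range_add_le _ _)).trans ?_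
  exact Submodule.finrank_add_le_finrank_add_finrank _ _

theorem HankelApproximable.add {n : ℕ} {A₁ A₂ : Matrix (Fin n) (Fin n) ℝ} {R₁ R₂ : ℕ}
    {η₁ η₂ : ℝ} (h₁ : HankelApproximable A₁ R₁ η₁) (h₂ : HankelApproximable A₂ R₂ η₂)
    (hA₁ : A₁.PosSemidef) (hA₂ : A₂.PosSemidef) (hη₁ : 0 ≤ η₁) (hη₂ : 0 ≤ η₂) :
    HankelApproximable (A₁ + A₂) (R₁ + R₂) (η₁ + η₂) := by
  obtain ⟨B₁, hB₁, hR₁, hs₁, hf₁⟩ := h₁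
  obtain ⟨B₂, hB₂, hR₂, hs₂, hf₂⟩ := h₂
  refine ⟨B₁ + B₂, hB₁.add hB₂,
    (Matrix.rank_add_le_rank_add_rank _ _).trans (add_le_add hR₁ hR₂), ?_, ?_⟩
  · rw [add_sub_add_comm, add_mul]
    refine (matrixSpectralNorm_add_le _ _).trans (add_le_add (hs₁.trans ?_) (hs₂.trans ?_))
    · exact mul_le_mul_of_nonneg_left (hA₁.spectralNorm_le_add hA₂) hη₁
    · rw [add_comm]
      exact mul_le_mul_of_nonneg_left (hA₂.spectralNorm_le_add hA₁) hη₂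
  · rw [add_sub_add_comm, add_mul]
    refine (matrixFrobeniusNorm_add_le _ _).trans (add_le_add (hf₁.trans ?_) (hf₂.trans ?_))
    · exact mul_le_mul_of_nonneg_left (hA₁.frobeniusNorm_le_add hA₂) hη₁
    · rw [add_comm]
      exact mul_le_mul_of_nonneg_left (hA₂.frobeniusNorm_le_add hA₁) hη₂

theorem matrixSpectralNorm_submatrix_rev {n : ℕ} (A : Matrix (Fin n) (Fin n) ℝ) :
    matrixSpectralNorm (A.submatrix Fin.rev Fin.rev) = matrixSpectralNorm A := by
  have hf : ∀ a : Fin n, (Finset.univ.filter fun i => Fin.rev i = a).card ≤ 1 := fun a =>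
    Finset.card_le_one.2 fun i hi j hj => Fin.rev_injective
      ((Finset.mem_filter.1 hi).2.trans (Finset.mem_filter.1 hj).2.symm)
  refine le_antisymm (by simpa using matrixSpectralNorm_submatrix_le hf A) ?_
  simpa [Matrix.submatrix_submatrix, Fin.rev_involutive.comp_self] using
    matrixSpectralNorm_submatrix_le hf (A.submatrix Fin.rev Fin.rev)

theorem matrixFrobeniusNorm_submatrix_rev {n : ℕ} (A : Matrix (Fin n) (Fin n) ℝ) :
    matrixFrobeniusNorm (A.submatrix Fin.rev Fin.rev) = matrixFrobeniusNorm A := by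
  have hf : ∀ a : Fin n, (Finset.univ.filter fun i => Fin.rev i = a).card ≤ 1 := fun a =>
    Finset.card_le_one.2 fun i hi j hj => Fin.rev_injective
      ((Finset.mem_filter.1 hi).2.trans (Finset.mem_filter.1 hj).2.symm)
  refine le_antisymm (by simpa using matrixFrobeniusNorm_submatrix_le hf A) ?_
  simpa [Matrix.submatrix_submatrix, Fin.rev_involutive.comp_self] using
    matrixFrobeniusNorm_submatrix_le hf (A.submatrix Fin.rev Fin.rev)

theorem HankelApproximable.submatrix_rev {n : ℕ} {A : Matrix (Fin n) (Fin n) ℝ} {R : ℕ} {η : ℝ}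
    (h : HankelApproximable A R η) :
    HankelApproximable (A.submatrix Fin.rev Fin.rev) R η := by
  obtain ⟨B, hB, hR, hs, hf⟩ := h
  have hsub : A.submatrix Fin.rev Fin.rev - B.submatrix Fin.rev Fin.rev =
      (A - B).submatrix Fin.rev Fin.rev := rfl
  refine ⟨B.submatrix Fin.rev Fin.rev, fun i j k l h => hB _ _ _ _ ?_, ?_, ?_, ?_⟩
  · simp only [Fin.val_rev]
    omega
  · exact (Matrix.rank_submatrix B Fin.revPerm Fin.revPerm).trans_le hR
  · rw [hsub, matrixSpectralNorm_submatrix_rev,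
      matrixSpectralNorm_submatrix_rev]
    exact hs
  · rw [hsub, matrixFrobeniusNorm_submatrix_rev,
      matrixFrobeniusNorm_submatrix_rev]
    exact hf

/-- Conjugation by the diagonal matrix with entries `(-1) ^ i`. It turns the moments of a measure
into those of its reflection in the origin. -/
def signConj {n : ℕ} (A : Matrix (Fin n) (Fin n) ℝ) : Matrix (Fin n) (Fin n) ℝ :=
  Matrix.of fun i j => (-1) ^ ((i : ℕ) + j) * A i j

theorem signConj_signConj {n : ℕ} (A : Matrix (Fin n) (Fin n) ℝ) : signConj (signConj A) = A := by
  ext i j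
  simp only [signConj, Matrix.of_apply, ← mul_assoc, ← mul_pow]
  simp

theorem signConj_eq {n : ℕ} (A : Matrix (Fin n) (Fin n) ℝ) :
    signConj A = Matrix.diagonal (fun i : Fin n => (-1 : ℝ) ^ (i : ℕ)) * A *
      Matrix.diagonal (fun i : Fin n => (-1 : ℝ) ^ (i : ℕ)) := by
  ext i j
  rw [Matrix.mul_diagonal, Matrix.diagonal_mul, signConj, Matrix.of_apply, pow_add]
  ring

open scoped Matrix.Norms.L2Operator in
theorem matrixSpectralNorm_signConj {n : ℕ} (A : Matrix (Fin n) (Fin n) ℝ) :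
    matrixSpectralNorm (signConj A) = matrixSpectralNorm A := by
  have h : ∀ A : Matrix (Fin n) (Fin n) ℝ,
      matrixSpectralNorm (signConj A) ≤ matrixSpectralNorm A := by
    intro A
    have hD : ‖Matrix.diagonal (fun i : Fin n => (-1 : ℝ) ^ (i : ℕ))‖ ≤ 1 := by
      rw [Matrix.l2_opNorm_diagonal]
      refine (pi_norm_le_iff_of_nonneg zero_le_one).2 fun i => ?_
      simp
    rw [signConj_eq]
    unfold matrixSpectralNorm
    calc _ ≤ _ * ‖A‖ * _ := (norm_mul_le _ _).trans
          (mul_le_mul_of_nonneg_right (norm_mul_le _ _) (norm_nonneg _))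
      _ ≤ 1 * ‖A‖ * 1 := by gcongr
      _ = ‖A‖ := by ring
  refine le_antisymm (h A) ?_
  simpa only [signConj_signConj] using h (signConj A)

theorem matrixFrobeniusNorm_signConj {n : ℕ} (A : Matrix (Fin n) (Fin n) ℝ) :
    matrixFrobeniusNorm (signConj A) = matrixFrobeniusNorm A := by
  simp [matrixFrobeniusNorm_eq, signConj, mul_pow, ← pow_mul]

theorem HankelApproximable.signConj {n : ℕ} {A : Matrix (Fin n) (Fin n) ℝ} {R : ℕ} {η : ℝ}
    (h : HankelApproximable A R η) : HankelApproximable (signConj A) R η := by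
  obtain ⟨B, hB, hR, hs, hf⟩ := h
  have hsub : _root_.signConj A - _root_.signConj B = _root_.signConj (A - B) := by
    ext i j
    simp only [_root_.signConj, Matrix.of_apply, Matrix.sub_apply]
    ring
  refine ⟨_root_.signConj B, fun i j k l h => ?_, ?_, ?_, ?_⟩
  · simp only [_root_.signConj, Matrix.of_apply]
    rw [h, hB i j k l h]
  · rw [signConj_eq]
    exact ((Matrix.rank_mul_le_left _ _).trans (Matrix.rank_mul_le_right _ _)).trans hR
  · rwa [hsub, matrixSpectralNorm_signConj, matrixSpectralNorm_signConj]
  · rwa [hsub, matrixFrobeniusNorm_signConj, matrixFrobeniusNorm_signConj]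

/-! ### Taylor expansions of powers -/

open Polynomial in
/-- The remainder of the Taylor expansion of `x ^ k` at `a` after `r` terms. Each omitted term has
degree at least `r` in `x - a`, so doubling `|x - a|` gains a factor `2 ^ r`. -/
theorem abs_pow_sub_taylor_le {a : ℝ} (ha : 0 ≤ a) (x : ℝ) (r k : ℕ) :
    |x ^ k - ∑ l ∈ Finset.range r, (x - a) ^ l * ((X + C a) ^ k).coeff l| ≤
      (1 / 2) ^ r * (a + 2 * |x - a|) ^ k := by
  have expand : ∀ y : ℝ, (y + a) ^ k =
      ∑ l ∈ Finset.range (r + (k + 1)), y ^ l * ((X + C a) ^ k).coeff l := by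
    intro y
    rw [add_pow]
    refine (Finset.sum_subset_zero_on_sdiff (Finset.range_mono (by omega)) ?_ ?_)
    · intro l hl
      have : k < l := by simp at hl; omega
      rw [coeff_X_add_C_pow, Nat.choose_eq_zero_of_lt this]
      simp
    · intro l _
      rw [coeff_X_add_C_pow]
      ring
  have hc : ∀ l, 0 ≤ ((X + C a) ^ k).coeff l := fun l => by
    rw [coeff_X_add_C_pow]
    positivity
  have h1 := expand (x - a)
  have h2 := expand (2 * |x - a|)
  rw [sub_add_cancel, Finset.sum_range_add] at h1
  rw [Finset.sum_range_add] at h2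
  have h3 : 0 ≤ ∑ l ∈ Finset.range r, (2 * |x - a|) ^ l * ((X + C a) ^ k).coeff l :=
    Finset.sum_nonneg fun l _ => mul_nonneg (by positivity) (hc l)
  rw [h1, add_sub_cancel_left, add_comm a, h2, mul_add]
  refine le_add_of_nonneg_of_le (by positivity) ?_
  rw [Finset.mul_sum]
  refine (Finset.abs_sum_le_sum_abs _ _).trans (Finset.sum_le_sum fun m _ => ?_)
  rw [abs_mul, abs_of_nonneg (hc _), abs_pow, mul_pow, ← mul_assoc, ← mul_assoc]
  refine mul_le_mul_of_nonneg_right ?_ (hc _)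
  refine le_mul_of_one_le_left (by positivity) ?_
  rw [pow_add, ← mul_assoc, ← mul_pow]
  norm_num
  exact one_le_pow₀ (by norm_num)

/-- Every point of `[0, 1]` is well placed with respect to one of the centres `1 - (3/4)^p`, `p ≤ N`:
the majorant `(a + 2 |x - a|)^k` of the Taylor remainder is at most a power of `x` whose exponent
is three times smaller. Only exponents up to `2 * n` matter, so logarithmically many centres
suffice. -/
theorem exists_centre_pow_le {n N : ℕ} (hN : (3 / 4 : ℝ) ^ N * (4 * n) ≤ 1) {x : ℝ} (hx0 : 0 ≤ x)
    (hx1 : x ≤ 1) :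
    ∃ p : Fin (N + 1), ∀ k q : ℕ, k ≤ 2 * n → 3 * q ≤ k →
      (1 - (3 / 4) ^ (p : ℕ) + 2 * |x - (1 - (3 / 4) ^ (p : ℕ))|) ^ k ≤ 4 * x ^ q := by
  classical
  let P : ℕ → Prop := fun p => 1 - (3 / 4 : ℝ) ^ p ≤ x
  have hP0 : P 0 := by simpa [P] using hx0
  -- The centre is the last one to the left of `x`.
  set p := Nat.findGreatest P N
  have hpN : p ≤ N := Nat.findGreatest_le N
  have hPp : 1 - (3 / 4 : ℝ) ^ p ≤ x := Nat.findGreatest_spec (P := P) (Nat.zero_le N) hP0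
  refine ⟨⟨p, by omega⟩, fun k q hk hq => ?_⟩
  simp only
  rw [abs_of_nonneg (sub_nonneg.2 hPp)]
  set δ : ℝ := (3 / 4) ^ p with hδ
  have hδ0 : 0 < δ := by positivity
  have hδ1 : δ ≤ 1 := pow_le_one₀ (by norm_num) (by norm_num)
  set y : ℝ := 1 - δ + 2 * (x - (1 - δ)) with hy
  have hy0 : 0 ≤ y := by linarith
  rcases hpN.lt_or_eq with hlt | heq
  · have hnP : x < 1 - 3 / 4 * δ := by
      have := Nat.findGreatest_is_greatest (P := P) (n := N) (k := p + 1) (by omega) (by omega)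
      simp only [P, not_le, pow_succ] at this
      linarith
    have hy1 : y ≤ 1 := by linarith
    have hcube : y ^ 3 ≤ x := by
      rcases Nat.eq_zero_or_pos p with h0 | h0
      · have : δ = 1 := by rw [hδ, h0, pow_zero]
        have hyx : y = 2 * x := by rw [hy, this]; ring
        rw [hyx]
        have : x ≤ 1 / 4 := by linarith
        nlinarith [mul_nonneg hx0 (mul_nonneg hx0 (sub_nonneg.2 this)),
          mul_nonneg hx0 (sub_nonneg.2 this)]
      · have hδ34 : δ ≤ 3 / 4 := by
          rw [hδ]
          exact (pow_le_pow_of_le_one (by norm_num) (by norm_num) h0).trans (by norm_num)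
        -- `y ≤ 1 - 2/3 (1 - x)`, with `1 - x ≤ 3/4`.
        have hys : y ≤ 1 - 2 / 3 * (1 - x) := by linarith
        refine (pow_le_pow_left₀ hy0 hys 3).trans ?_
        have hs0 : 0 ≤ 1 - x := by linarith
        have hs1 : 1 - x ≤ 3 / 4 := by linarith
        nlinarith [mul_nonneg hs0 (sub_nonneg.2 hs1), pow_nonneg hs0 3]
    calc y ^ k ≤ y ^ (3 * q) := pow_le_pow_of_le_one hy0 hy1 hq
      _ = (y ^ 3) ^ q := pow_mul _ _ _
      _ ≤ x ^ q := pow_le_pow_left₀ (by positivity) hcube q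
      _ ≤ 4 * x ^ q := by linarith [pow_nonneg hx0 q]
  · -- All powers in play stay within a factor `2` of `1`.
    have hδn : δ * (4 * n) ≤ 1 := by rw [hδ, heq]; exact hN
    rcases Nat.eq_zero_or_pos n with h0 | hn
    · have hk0 : k = 0 := by omega
      have hq0 : q = 0 := by omega
      rw [hk0, hq0]
      norm_num
    have hn1 : (1 : ℝ) ≤ n := by exact_mod_cast hn
    have hδ4 : δ ≤ 1 / 4 := by nlinarith
    have hlow : 1 / 2 ≤ (1 - δ) ^ (2 * n) := by
      have := one_add_mul_le_pow (a := -δ) (by linarith) (2 * n)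
      push_cast at this
      rw [← sub_eq_add_neg] at this
      linarith
    have hx2 : 1 / 2 ≤ x ^ q :=
      calc 1 / 2 ≤ (1 - δ) ^ (2 * n) := hlow
        _ ≤ x ^ (2 * n) := pow_le_pow_left₀ (by linarith) hPp _
        _ ≤ x ^ q := pow_le_pow_of_le_one hx0 hx1 (by omega)
    have hyk : y ^ k ≤ (1 + δ) ^ (2 * n) :=
      (pow_le_pow_left₀ hy0 (by linarith) k).trans (pow_le_pow_right₀ (by linarith) hk)
    have hprod : (1 + δ) ^ (2 * n) * (1 - δ) ^ (2 * n) ≤ 1 := by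
      rw [← mul_pow]
      exact pow_le_one₀ (by nlinarith) (by nlinarith)
    have hpos : 0 < (1 + δ) ^ (2 * n) := by positivity
    nlinarith

/-! ### Moment matrices -/

/-- The Hankel matrix of the moments of the discrete measure with mass `w t` at `x t`, `t ∈ s`. -/
def momentMatrix {ι : Type*} (n : ℕ) (s : Finset ι) (w x : ι → ℝ) : Matrix (Fin n) (Fin n) ℝ :=
  Matrix.of fun i j => ∑ t ∈ s, w t * x t ^ ((i : ℕ) + j)

theorem posSemidef_momentMatrix {ι : Type*} (n : ℕ) {s : Finset ι} {w : ι → ℝ} (x : ι → ℝ)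
    (hw : ∀ t ∈ s, 0 ≤ w t) : (momentMatrix n s w x).PosSemidef := by
  have : momentMatrix n s w x = ∑ t ∈ s, w t •
      Matrix.vecMulVec (fun i : Fin n => x t ^ (i : ℕ)) (star fun i : Fin n => x t ^ (i : ℕ)) := by
    ext i j
    simp [momentMatrix, Matrix.sum_apply, Matrix.vecMulVec_apply, pow_add]
  rw [this]
  exact Matrix.posSemidef_sum _ fun t ht =>
    (Matrix.posSemidef_vecMulVec_self_star _).smul (hw t ht)

open Polynomial in
/-- The span of `k ↦ coeff ((X + a)^k) l`, `l < r`, is invariant under translations of `k`, so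
each centre contributes at most `r` to the rank. -/
theorem rank_sum_taylor_le {ι : Type*} {n M : ℕ} (r : ℕ) (s : Finset ι) (c : ι → ℕ → ℝ)
    (p : ι → Fin M) (a : Fin M → ℝ) :
    (Matrix.of fun i j : Fin n => ∑ t ∈ s, ∑ l ∈ Finset.range r,
      c t l * ((X + C (a (p t))) ^ ((i : ℕ) + j)).coeff l).rank ≤ M * r := by
  classical
  let U : Matrix (Fin n) (Fin M × Fin r) ℝ :=
    Matrix.of fun i m => ((X + C (a m.1)) ^ (i : ℕ)).coeff m.2
  let W : Matrix (Fin M × Fin r) (Fin n) ℝ := Matrix.of fun m j =>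
    ∑ t ∈ s, if p t = m.1 then ∑ l ∈ Finset.range r,
      if (m.2 : ℕ) ≤ l then c t l * ((X + C (a m.1)) ^ (j : ℕ)).coeff (l - m.2) else 0 else 0
  have hUW : (Matrix.of fun i j : Fin n => ∑ t ∈ s, ∑ l ∈ Finset.range r,
      c t l * ((X + C (a (p t))) ^ ((i : ℕ) + j)).coeff l) = U * W := by
    ext i j
    simp only [Matrix.of_apply, Matrix.mul_apply, U, W, Finset.mul_sum]
    conv_rhs => rw [Finset.sum_comm]
    refine Finset.sum_congr rfl fun t _ => ?_
    rw [Fintype.sum_prod_type, Finset.sum_eq_single (p t) (fun b _ hb => by simp [hb.symm])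
      (by simp)]
    simp only [if_true, Finset.mul_sum]
    conv_rhs => rw [Finset.sum_comm]
    refine Finset.sum_congr rfl fun l hl => ?_
    rw [pow_add, coeff_mul, Finset.Nat.sum_antidiagonal_eq_sum_range_succ_mk, Finset.mul_sum]
    refine Eq.trans ?_ (Fin.sum_univ_eq_sum_range (fun u => ((X + C (a (p t))) ^ (i : ℕ)).coeff u *
      if u ≤ l then c t l * ((X + C (a (p t))) ^ (j : ℕ)).coeff (l - u) else 0) r).symm
    have hl' : l < r := Finset.mem_range.1 hl
    refine Finset.sum_subset_zero_on_sdiff (Finset.range_mono (by omega)) ?_ ?_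
    · intro u hu
      have : ¬ u ≤ l := by simp at hu; omega
      simp [this]
    · intro u hu
      have : u ≤ l := by simp at hu; omega
      simp only [this, if_true]
      ring
  rw [hUW]
  refine (Matrix.rank_mul_le_left _ _).trans ((Matrix.rank_le_card_width _).trans ?_)
  simp

open Polynomial in
/-- The approximant replaces each `x t ^ k` by its truncated Taylor expansion at the centre chosen
for `x t`. The error is entrywise at most `4 (1/2)^r` times the matrix obtained from the moment
matrix by repeating each row and column three times. -/
theorem hankelApproximable_of_mem_Icc {ι : Type*} {n N : ℕ}
    (hN : (3 / 4 : ℝ) ^ N * (4 * n) ≤ 1) (r : ℕ) {s : Finset ι} {w x : ι → ℝ}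
    (hw : ∀ t ∈ s, 0 ≤ w t) (hx : ∀ t ∈ s, 0 ≤ x t ∧ x t ≤ 1) :
    HankelApproximable (momentMatrix n s w x) ((N + 1) * r) (12 * (1 / 2) ^ r) := by
  classical
  let a : Fin (N + 1) → ℝ := fun p => 1 - (3 / 4) ^ (p : ℕ)
  have ha : ∀ p, 0 ≤ a p := fun p => sub_nonneg.2 (pow_le_one₀ (by norm_num) (by norm_num))
  have hex : ∀ t, ∃ p : Fin (N + 1), t ∈ s → ∀ k q : ℕ, k ≤ 2 * n → 3 * q ≤ k →
      (a p + 2 * |x t - a p|) ^ k ≤ 4 * x t ^ q := by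
    intro t
    by_cases ht : t ∈ s
    · obtain ⟨p, hp⟩ := exists_centre_pow_le hN (hx t ht).1 (hx t ht).2
      exact ⟨p, fun _ => hp⟩
    · exact ⟨0, fun h => absurd h ht⟩
  choose p hp using hex
  let third : Fin n → Fin n := fun i => ⟨i / 3, by omega⟩
  let B : Matrix (Fin n) (Fin n) ℝ := Matrix.of fun i j => ∑ t ∈ s, ∑ l ∈ Finset.range r,
    (w t * (x t - a (p t)) ^ l) * ((X + C (a (p t))) ^ ((i : ℕ) + j)).coeff l
  set A := momentMatrix n s w x with hA
  have hthird : ∀ b, (Finset.univ.filter fun i => third i = b).card ≤ 3 := by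
    intro b
    have hsub : ((Finset.univ.filter fun i => third i = b).image Fin.val) ⊆
        Finset.Ico (3 * (b : ℕ)) (3 * b + 3) := by
      intro m hm
      obtain ⟨i, hi, rfl⟩ := Finset.mem_image.1 hm
      have : (i : ℕ) / 3 = b := congrArg Fin.val (Finset.mem_filter.1 hi).2
      rw [Finset.mem_Ico]
      omega
    rw [← Finset.card_image_of_injective _ Fin.val_injective]
    exact (Finset.card_le_card hsub).trans (by simp)
  have hentry : ∀ i j, |(A - B) i j| ≤ ((4 * (1 / 2 : ℝ) ^ r) • A.submatrix third third) i j := by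
    intro i j
    have hAB : (A - B) i j = ∑ t ∈ s, w t * (x t ^ ((i : ℕ) + j) - ∑ l ∈ Finset.range r,
        (x t - a (p t)) ^ l * ((X + C (a (p t))) ^ ((i : ℕ) + j)).coeff l) := by
      simp only [hA, B, momentMatrix, Matrix.sub_apply, Matrix.of_apply, ← Finset.sum_sub_distrib,
        mul_sub, Finset.mul_sum, mul_assoc]
    rw [hAB]
    refine (Finset.abs_sum_le_sum_abs _ _).trans ?_
    simp only [hA, momentMatrix, Matrix.smul_apply, Matrix.submatrix_apply, Matrix.of_apply,
      smul_eq_mul, Finset.mul_sum]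
    refine Finset.sum_le_sum fun t ht => ?_
    rw [abs_mul, abs_of_nonneg (hw t ht)]
    have h1 := abs_pow_sub_taylor_le (ha (p t)) (x t) r ((i : ℕ) + j)
    have h2 := hp t ht ((i : ℕ) + j) ((i : ℕ) / 3 + (j : ℕ) / 3) (by omega) (by omega)
    calc _ ≤ w t * ((1 / 2) ^ r * (4 * x t ^ ((i : ℕ) / 3 + (j : ℕ) / 3))) :=
          mul_le_mul_of_nonneg_left
            (h1.trans (mul_le_mul_of_nonneg_left h2 (by positivity))) (hw t ht)
      _ = _ := by simp only [third]; ring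
  have hc : |4 * (1 / 2 : ℝ) ^ r| = 4 * (1 / 2 : ℝ) ^ r := abs_of_nonneg (by positivity)
  refine ⟨B, fun i j k l h => ?_, ?_, ?_, ?_⟩
  · simp only [B, Matrix.of_apply, h]
  · exact rank_sum_taylor_le r s _ p a
  · refine (matrixSpectralNorm_mono hentry).trans ?_
    rw [matrixSpectralNorm_smul, hc]
    calc _ ≤ 4 * (1 / 2 : ℝ) ^ r * ((3 : ℕ) * matrixSpectralNorm A) :=
          mul_le_mul_of_nonneg_left (matrixSpectralNorm_submatrix_le hthird A) (by positivity)
      _ = _ := by push_cast; ring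
  · refine (matrixFrobeniusNorm_mono hentry).trans ?_
    rw [matrixFrobeniusNorm_smul, hc]
    calc _ ≤ 4 * (1 / 2 : ℝ) ^ r * ((3 : ℕ) * matrixFrobeniusNorm A) :=
          mul_le_mul_of_nonneg_left (matrixFrobeniusNorm_submatrix_le hthird A) (by positivity)
      _ = _ := by push_cast; ring

theorem momentMatrix_eq_filter_add_filter {ι : Type*} (n : ℕ) (s : Finset ι) (w x : ι → ℝ)
    (P : ι → Prop) [DecidablePred P] :
    momentMatrix n s w x =
      momentMatrix n (s.filter P) w x + momentMatrix n (s.filter fun t => ¬ P t) w x := by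
  ext i j
  simp only [momentMatrix, Matrix.of_apply, Matrix.add_apply]
  exact (Finset.sum_filter_add_sum_filter_not s P _).symm

theorem signConj_momentMatrix {ι : Type*} (n : ℕ) (s : Finset ι) (w x : ι → ℝ) :
    signConj (momentMatrix n s w fun t => -x t) = momentMatrix n s w x := by
  ext i j
  simp only [signConj, momentMatrix, Matrix.of_apply, Finset.mul_sum]
  refine Finset.sum_congr rfl fun t _ => ?_
  rw [mul_left_comm, ← mul_pow, neg_one_mul, neg_neg]

theorem submatrix_rev_momentMatrix {ι : Type*} (n : ℕ) {s : Finset ι} (w : ι → ℝ) {x : ι → ℝ}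
    (hx : ∀ t ∈ s, x t ≠ 0) :
    (momentMatrix n s (fun t => w t * x t ^ (2 * (n - 1))) fun t => (x t)⁻¹).submatrix
      Fin.rev Fin.rev = momentMatrix n s w x := by
  ext i j
  simp only [momentMatrix, Matrix.of_apply, Matrix.submatrix_apply, Fin.val_rev]
  refine Finset.sum_congr rfl fun t ht => ?_
  have h : 2 * (n - 1) = ((i : ℕ) + j) + (n - (i + 1) + (n - (j + 1))) := by omega
  rw [h, pow_add, mul_assoc, mul_assoc, inv_pow, mul_inv_cancel₀ (pow_ne_zero _ (hx t ht)), mul_one]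

/-- Nodes in `[-1, 1]`. -/
theorem hankelApproximable_of_abs_le_one {ι : Type*} {n N : ℕ}
    (hN : (3 / 4 : ℝ) ^ N * (4 * n) ≤ 1) (r : ℕ) {s : Finset ι} {w x : ι → ℝ}
    (hw : ∀ t ∈ s, 0 ≤ w t) (hx : ∀ t ∈ s, |x t| ≤ 1) :
    HankelApproximable (momentMatrix n s w x) ((N + 1) * r + (N + 1) * r)
      (12 * (1 / 2) ^ r + 12 * (1 / 2) ^ r) := by
  classical
  rw [momentMatrix_eq_filter_add_filter n s w x fun t => 0 ≤ x t]
  refine HankelApproximable.add (hankelApproximable_of_mem_Icc hN r ?_ ?_) ?_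
    (posSemidef_momentMatrix n x ?_) (posSemidef_momentMatrix n x ?_) (by positivity)
    (by positivity)
  · exact fun t ht => hw t (Finset.mem_filter.1 ht).1
  · intro t ht
    obtain ⟨h1, h2⟩ := Finset.mem_filter.1 ht
    exact ⟨h2, (abs_le.1 (hx t h1)).2⟩
  · rw [← signConj_momentMatrix]
    refine (hankelApproximable_of_mem_Icc hN r ?_ ?_).signConj
    · exact fun t ht => hw t (Finset.mem_filter.1 ht).1
    · intro t ht
      obtain ⟨h1, h2⟩ := Finset.mem_filter.1 ht
      have := (abs_le.1 (hx t h1)).1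
      constructor <;> linarith
  · exact fun t ht => hw t (Finset.mem_filter.1 ht).1
  · exact fun t ht => hw t (Finset.mem_filter.1 ht).1

/-- Nodes outside `[-1, 1]` are brought inside by `x ↦ x⁻¹`, which on Hankel matrices is the
reversal of rows and columns. -/
theorem hankelApproximable_momentMatrix {ι : Type*} {n N : ℕ}
    (hN : (3 / 4 : ℝ) ^ N * (4 * n) ≤ 1) (r : ℕ) {s : Finset ι} {w x : ι → ℝ}
    (hw : ∀ t ∈ s, 0 ≤ w t) :
    HankelApproximable (momentMatrix n s w x) (4 * ((N + 1) * r)) (48 * (1 / 2) ^ r) := by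
  classical
  have hR : 4 * ((N + 1) * r) = ((N + 1) * r + (N + 1) * r) + ((N + 1) * r + (N + 1) * r) := by ring
  have hη : 48 * (1 / 2 : ℝ) ^ r = (12 * (1 / 2) ^ r + 12 * (1 / 2) ^ r) +
      (12 * (1 / 2) ^ r + 12 * (1 / 2) ^ r) := by ring
  rw [hR, hη, momentMatrix_eq_filter_add_filter n s w x fun t => |x t| ≤ 1]
  refine HankelApproximable.add (hankelApproximable_of_abs_le_one hN r ?_ ?_) ?_
    (posSemidef_momentMatrix n x ?_) (posSemidef_momentMatrix n x ?_) (by positivity)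
    (by positivity)
  · exact fun t ht => hw t (Finset.mem_filter.1 ht).1
  · exact fun t ht => (Finset.mem_filter.1 ht).2
  · rw [← submatrix_rev_momentMatrix]
    · refine (hankelApproximable_of_abs_le_one hN r ?_ ?_).submatrix_rev
      · intro t ht
        refine mul_nonneg (hw t (Finset.mem_filter.1 ht).1) ?_
        rw [pow_mul]
        positivity
      · intro t ht
        rw [abs_inv]
        exact inv_le_one_of_one_le₀ (not_le.1 (Finset.mem_filter.1 ht).2).le
    · intro t ht h0
      have := (Finset.mem_filter.1 ht).2
      simp [h0] at this
  · exact fun t ht => hw t (Finset.mem_filter.1 ht).1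
  · exact fun t ht => hw t (Finset.mem_filter.1 ht).1

/-! ### Positive definite Hankel matrices are moment matrices -/

/-- A positive definite Hankel matrix is the moment matrix of a discrete positive measure
(Gauss quadrature). In the inner product given by `H`, the operator `e_j ↦ e_{j+1}` extends to a
self-adjoint one, whose eigenvalues are the nodes. -/
theorem IsHankel.exists_eq_momentMatrix {n : ℕ} {H : Matrix (Fin n) (Fin n) ℝ}
    (hH : IsHankel H) (hpd : H.PosDef) :
    ∃ w x : Fin n → ℝ, (∀ t, 0 ≤ w t) ∧ H = momentMatrix n Finset.univ w x := by
  classical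
  rcases Nat.eq_zero_or_pos n with rfl | hn
  · exact ⟨0, 0, fun _ => le_rfl, by ext i; exact i.elim0⟩
  obtain ⟨S, hS, hHS⟩ := hpd.exists_isUnit_eq_conjTranspose_mul_self
  rw [Matrix.conjTranspose_eq_transpose_of_trivial] at hHS
  have hSdet : IsUnit S.det := (Matrix.isUnit_iff_isUnit_det S).1 hS
  have hSTdet : IsUnit S.transpose.det := by rwa [Matrix.det_transpose]
  -- `h k` is the common value of `H` on the antidiagonal `i + j = k`, and `0` where there is none.
  let h : ℕ → ℝ := fun k =>
    if hk : k ≤ 2 * (n - 1) then H ⟨k / 2, by omega⟩ ⟨k - k / 2, by omega⟩ else 0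
  have hh : ∀ i j : Fin n, H i j = h (i + j) := by
    intro i j
    have : (i : ℕ) + j ≤ 2 * (n - 1) := by omega
    simp only [h, this, dif_pos]
    refine hH _ _ _ _ ?_
    simp only
    omega
  let K : Matrix (Fin n) (Fin n) ℝ := Matrix.of fun i j => h (i + j + 1)
  let M : Matrix (Fin n) (Fin n) ℝ := S.transpose⁻¹ * K * S⁻¹
  have hK : K.transpose = K := by
    ext i j
    simp only [K, Matrix.transpose_apply, Matrix.of_apply, add_comm (j : ℕ)]
  have hM : M.IsHermitian := by
    rw [Matrix.IsHermitian, Matrix.conjTranspose_eq_transpose_of_trivial]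
    simp only [M, Matrix.transpose_mul, Matrix.transpose_nonsing_inv, Matrix.transpose_transpose,
      hK, Matrix.mul_assoc]
  have hMS : M * S = S.transpose⁻¹ * K := by
    rw [Matrix.mul_assoc, Matrix.nonsing_inv_mul _ hSdet, Matrix.mul_one]
  have hSH : S = S.transpose⁻¹ * H := by
    rw [hHS, ← Matrix.mul_assoc, Matrix.nonsing_inv_mul _ hSTdet, Matrix.one_mul]
  have hstep : ∀ (j : ℕ) (hj : j + 1 < n),
      S.col ⟨j + 1, hj⟩ = M.mulVec (S.col ⟨j, by omega⟩) := by
    intro j hj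
    have h1 : M.mulVec (S.col ⟨j, by omega⟩) = (M * S).col ⟨j, by omega⟩ := by
      ext i; simp [Matrix.mulVec, Matrix.mul_apply, dotProduct, Matrix.col]
    rw [h1, hMS]
    conv_lhs => rw [hSH]
    ext i
    simp only [Matrix.col_apply, Matrix.mul_apply, K, Matrix.of_apply]
    refine Finset.sum_congr rfl fun l _ => ?_
    rw [hh]
    rfl
  -- In an orthonormal eigenbasis of `M`, the columns of `S` are `λ_t ^ j` times the first one.
  set b := hM.eigenvectorBasis
  have hcoef : ∀ (t : Fin n) (j : ℕ) (hj : j < n),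
      dotProduct (b t).ofLp (S.col ⟨j, hj⟩) =
        hM.eigenvalues t ^ j * dotProduct (b t).ofLp (S.col ⟨0, hn⟩) := by
    intro t j
    induction j with
    | zero => intro hj; simp
    | succ j ih =>
      intro hj
      have hvec := hM.mulVec_eigenvectorBasis t
      rw [hstep j hj, Matrix.dotProduct_mulVec, ← Matrix.mulVec_transpose,
        show M.transpose = M by rw [← Matrix.conjTranspose_eq_transpose_of_trivial]; exact hM,
        hvec, smul_dotProduct, ih, pow_succ, smul_eq_mul]
      ring
  refine ⟨fun t => (dotProduct (b t).ofLp (S.col ⟨0, hn⟩)) ^ 2, hM.eigenvalues,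
    fun t => sq_nonneg _, ?_⟩
  ext i j
  have hinner := b.sum_inner_mul_inner (WithLp.toLp 2 (S.col i)) (WithLp.toLp 2 (S.col j))
  have e1 : inner ℝ (WithLp.toLp 2 (S.col i)) (WithLp.toLp 2 (S.col j)) = H i j := by
    rw [EuclideanSpace.inner_eq_star_dotProduct, hHS]
    simp [Matrix.mul_apply, dotProduct, mul_comm]
  have e2 : ∀ (t k : Fin n), dotProduct (b t).ofLp (S.col k) =
      hM.eigenvalues t ^ (k : ℕ) * dotProduct (b t).ofLp (S.col ⟨0, hn⟩) :=
    fun t k => hcoef t k k.2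
  rw [← e1, ← hinner, momentMatrix, Matrix.of_apply]
  refine Finset.sum_congr rfl fun t _ => ?_
  rw [EuclideanSpace.inner_eq_star_dotProduct, EuclideanSpace.inner_eq_star_dotProduct]
  simp only [star_trivial]
  rw [dotProduct_comm (S.col j), e2 t i, e2 t j, pow_add]
  ring

/-! ### Approximation of positive semidefinite Hankel matrices -/

theorem exists_isHankel_posDef (n : ℕ) :
    ∃ V : Matrix (Fin n) (Fin n) ℝ, IsHankel V ∧ V.PosDef := by
  let v : Fin n → ℝ := fun i => (i : ℕ)
  have hv : Function.Injective v := fun i j h => Fin.ext (Nat.cast_injective (R := ℝ) h)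
  refine ⟨(Matrix.vandermonde v).conjTranspose * Matrix.vandermonde v, fun i j k l h => ?_,
    Matrix.PosDef.conjTranspose_mul_self _ ?_⟩
  · simp only [Matrix.mul_apply, Matrix.conjTranspose_apply, Matrix.vandermonde_apply,
      star_trivial, ← pow_add, h]
  · rw [Matrix.mulVec_injective_iff_isUnit, Matrix.isUnit_iff_isUnit_det]
    exact (Matrix.det_vandermonde_ne_zero_iff.2 hv).isUnit

/-- A small positive definite perturbation reduces the semidefinite case to the definite one. -/
theorem IsHankel.hankelApproximable {n N : ℕ} (hN : (3 / 4 : ℝ) ^ N * (4 * n) ≤ 1) (r : ℕ)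
    {H : Matrix (Fin n) (Fin n) ℝ} (hH : IsHankel H) (hpsd : H.PosSemidef) :
    HankelApproximable H (4 * ((N + 1) * r)) (96 * (1 / 2) ^ r) := by
  set η : ℝ := 48 * (1 / 2) ^ r with hη
  have hη0 : 0 < η := by positivity
  rcases eq_or_ne H 0 with rfl | hne
  · have hs : matrixSpectralNorm (0 : Matrix (Fin n) (Fin n) ℝ) = 0 := by
      simpa using matrixSpectralNorm_smul 0 (0 : Matrix (Fin n) (Fin n) ℝ)
    have hf : matrixFrobeniusNorm (0 : Matrix (Fin n) (Fin n) ℝ) = 0 := by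
      simpa using matrixFrobeniusNorm_smul 0 (0 : Matrix (Fin n) (Fin n) ℝ)
    exact ⟨0, fun _ _ _ _ _ => rfl, by simp, by simp [hs], by simp [hf]⟩
  obtain ⟨V, hV, hVpd⟩ := exists_isHankel_posDef n
  have hs := matrixSpectralNorm_pos hne
  have hf := matrixFrobeniusNorm_pos hne
  have hVs := matrixSpectralNorm_nonneg V
  have hVf := matrixFrobeniusNorm_nonneg V
  obtain ⟨c, hc, hcs, hcf⟩ : ∃ c : ℝ, 0 < c ∧
      c * ((1 + η) * matrixSpectralNorm V) ≤ η * matrixSpectralNorm H ∧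
      c * ((1 + η) * matrixFrobeniusNorm V) ≤ η * matrixFrobeniusNorm H := by
    have key : ∀ a b : ℝ, 0 ≤ a → 0 < b → 0 < b / (a + 1) ∧ ∀ c ≤ b / (a + 1), c * a ≤ b := by
      intro a b ha hb
      refine ⟨by positivity, fun c hc => ?_⟩
      calc c * a ≤ b / (a + 1) * (a + 1) := by
            have : 0 < b / (a + 1) := by positivity
            nlinarith [mul_le_mul_of_nonneg_right hc ha]
        _ = b := by field_simp
    obtain ⟨p1, q1⟩ := key ((1 + η) * matrixSpectralNorm V) (η * matrixSpectralNorm H)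
      (by positivity) (by positivity)
    obtain ⟨p2, q2⟩ := key ((1 + η) * matrixFrobeniusNorm V) (η * matrixFrobeniusNorm H)
      (by positivity) (by positivity)
    exact ⟨_, lt_min p1 p2, q1 _ (min_le_left _ _), q2 _ (min_le_right _ _)⟩
  have hpd : (H + c • V).PosDef := Matrix.PosDef.posSemidef_add hpsd (hVpd.smul hc)
  obtain ⟨w, x, hw, hwx⟩ := (hH.add (hV.smul c)).exists_eq_momentMatrix hpd
  obtain ⟨B, hB, hR, hBs, hBf⟩ :=
    hankelApproximable_momentMatrix (n := n) hN r (s := Finset.univ) (x := x) fun t _ => hw t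
  rw [← hwx] at hBs hBf
  have hsplit : H - B = (H + c • V - B) + (-c) • V := by
    rw [neg_smul]
    abel
  refine ⟨B, hB, hR, ?_, ?_⟩
  · have h1 := matrixSpectralNorm_add_le (H + c • V - B) ((-c) • V)
    have h2 := matrixSpectralNorm_add_le H (c • V)
    rw [matrixSpectralNorm_smul, abs_neg, abs_of_pos hc, ← hsplit] at h1
    rw [matrixSpectralNorm_smul, abs_of_pos hc] at h2
    have h3 := mul_le_mul_of_nonneg_left h2 hη0.le
    rw [show (96 : ℝ) * (1 / 2) ^ r = 2 * η by rw [hη]; ring]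
    nlinarith
  · have h1 := matrixFrobeniusNorm_add_le (H + c • V - B) ((-c) • V)
    have h2 := matrixFrobeniusNorm_add_le H (c • V)
    rw [matrixFrobeniusNorm_smul, abs_neg, abs_of_pos hc, ← hsplit] at h1
    rw [matrixFrobeniusNorm_smul, abs_of_pos hc] at h2
    have h3 := mul_le_mul_of_nonneg_left h2 hη0.le
    rw [show (96 : ℝ) * (1 / 2) ^ r = 2 * η by rw [hη]; ring]
    nlinarith

theorem theorem2 :
    ∃ C : ℝ, 0 < C ∧
      ∀ (n : ℕ) (H : Matrix (Fin n) (Fin n) ℝ) (ε : ℝ),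
        IsHankel H → H.PosSemidef → 0 < ε →
          ∃ Hhat : Matrix (Fin n) (Fin n) ℝ,
            IsHankel Hhat ∧
            (Hhat.rank : ℝ) ≤ C * max 1 (Real.logb 2 (n : ℝ)) * max 1 (Real.logb 2 (1 / ε)) ∧
            matrixSpectralNorm (H - Hhat) ≤ ε * matrixSpectralNorm H ∧
            matrixFrobeniusNorm (H - Hhat) ≤ ε * matrixFrobeniusNorm H := by
  refine ⟨468, by norm_num, fun n H ε hH hpsd hε => ?_⟩
  set L := max 1 (Real.logb 2 (n : ℝ)) with hL
  set J := max 1 (Real.logb 2 (1 / ε)) with hJ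
  have hL1 : 1 ≤ L := le_max_left _ _
  have hJ1 : 1 ≤ J := le_max_left _ _
  have hnL : (n : ℝ) ≤ 2 ^ L := by
    rcases Nat.eq_zero_or_pos n with rfl | hn
    · rw [Nat.cast_zero]; positivity
    · rw [← Real.logb_le_iff_le_rpow (by norm_num) (by exact_mod_cast hn)]
      exact le_max_right _ _
  have hεJ : 1 / ε ≤ 2 ^ J := by
    rw [← Real.logb_le_iff_le_rpow (by norm_num) (by positivity)]
    exact le_max_right _ _
  -- `(3/4)^3 ≤ 1/2`, so `N` takes `(3/4)^N` below `1/(4n)`.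
  set m := ⌈L⌉₊ with hm
  have hmL : (m : ℝ) < L + 1 := Nat.ceil_lt_add_one (by linarith)
  have hN : (3 / 4 : ℝ) ^ (3 * (m + 2)) * (4 * n) ≤ 1 := by
    have h1 : (n : ℝ) ≤ 2 ^ m := by
      refine hnL.trans ?_
      rw [← Real.rpow_natCast]
      exact Real.rpow_le_rpow_of_exponent_le (by norm_num) (Nat.le_ceil L)
    calc (3 / 4 : ℝ) ^ (3 * (m + 2)) * (4 * n) ≤ (1 / 2) ^ (m + 2) * (4 * 2 ^ m) := by
          rw [pow_mul]
          gcongr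
          norm_num
      _ = (1 / 2 * 2) ^ m := by rw [mul_pow, pow_add]; ring
      _ ≤ 1 := by norm_num
  set q := ⌈J⌉₊ with hq
  have hqJ : (q : ℝ) < J + 1 := Nat.ceil_lt_add_one (by linarith)
  have hr : 96 * (1 / 2 : ℝ) ^ (q + 7) ≤ ε := by
    have h1 : 1 / ε ≤ 2 ^ q := by
      refine hεJ.trans ?_
      rw [← Real.rpow_natCast]
      exact Real.rpow_le_rpow_of_exponent_le (by norm_num) (Nat.le_ceil J)
    have h2 : (1 / 2 : ℝ) ^ q ≤ ε := by
      rw [one_div, inv_pow]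
      rw [one_div] at h1
      exact inv_le_of_inv_le₀ hε h1
    rw [pow_add]
    norm_num at h2 ⊢
    linarith
  obtain ⟨B, hB, hR, hs, hf⟩ := hH.hankelApproximable hN (q + 7) hpsd
  refine ⟨B, hB, ?_, hs.trans ?_, hf.trans ?_⟩
  · have hR' : (B.rank : ℝ) ≤ 4 * ((3 * (m + 2) + 1) * (q + 7)) := by exact_mod_cast hR
    refine hR'.trans ?_
    have h1 : 3 * ((m : ℝ) + 2) + 1 ≤ 13 * L := by linarith
    have h2 : (q : ℝ) + 7 ≤ 9 * J := by linarith
    calc 4 * ((3 * ((m : ℝ) + 2) + 1) * (q + 7)) ≤ 4 * ((13 * L) * (9 * J)) := by gcongr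
      _ = 468 * L * J := by ring
  · exact mul_le_mul_of_nonneg_right hr (matrixSpectralNorm_nonneg _)
  · exact mul_le_mul_of_nonneg_right hr (matrixFrobeniusNorm_nonneg _)
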